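/- Let $K\in\mathbb N$, let $\mathcal X$ and $\mathcal Y_1,\dots,\mathcal Y_K$ be compact metric spaces, and let $c_k:\mathcal X\times\mathcal Y_k\to\mathbb R_+$ be continuous ($1\le k\le K$). Assume that for every $(y_1,\dots,y_K)\in\mathcal Y:=\mathcal Y_1\times\dots\times\mathcal Y_K$ the function $x\mapsto\sum_{k=1}^K c_k(x,y_k)$ has a unique minimiser over $\mathcal X$, denoted $B(y_1,\dots,y_K)$. Fix $\nu_k\in\mathcal P(\mathcal Y_k)$. For $\mu\in\mathcal P(\mathcal X)$ let $\Pi^*_{c_k}(\mu,\nu_k)$ be the set of couplings of $\mu$ and $\nu_k$ that minimise $\pi\mapsto\int c_k\,d\pi$ among all couplings of $\mu$ and $\nu_k$. Let $\Gamma_\otimes(\mu)$ be the set of $\gamma\in\mathcal P(\mathcal X\times\mathcal Y)$ for which there are $\pi_k\in\Pi^*_{c_k}(\mu,\nu_k)$, with disintegrations $\pi_k(dx,dy_k)=\mu(dx)\,\pi_k^x(dy_k)$, such that the $(x,y_k)$-marginal of $\gamma$ is $\pi_k$ for every $k$ and $$\gamma(dx,dy_1,\dots,dy_K)=\mu(dx)\,\pi_1^x(dy_1)\cdots\pi_K^x(dy_K).$$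 Let $G_\otimes(\mu):=\{B\#\gamma_{1,\dots,K}:\gamma\in\Gamma_\otimes(\mu)\}\subset\mathcal P(\mathcal X)$, where $\gamma_{1,\dots,K}$ is the marginal of $\gamma$ on $\mathcal Y$. Suppose that $\mu_0\in\mathcal P(\mathcal X)$ and $\nu_1,\dots,\nu_K$ have finite support, and let $(\mu_t)_{t\in\mathbb N}$ be any sequence in $\mathcal P(\mathcal X)$ with $\mu_{t+1}\in G_\otimes(\mu_t)$ for all $t$. If a subsequence of $(\mu_t)$ converges weakly to $\mu\in\mathcal P(\mathcal X)$, then $\mu\in G_\otimes(\mu)$. -/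

import Mathlib

open MeasureTheory ProbabilityTheory Filter Topology
open scoped NNReal ENNReal

noncomputable section

namespace OTBary

/-- A measure with finite support: it gives no mass to the complement of some finite set. -/
def FinitelySupported {E : Type*} [MeasurableSpace E] (μ : Measure E) : Prop :=
  ∃ s : Set E, s.Finite ∧ μ sᶜ = 0

section Coupling

variable {E F : Type*} [MeasurableSpace E] [MeasurableSpace F]

/-- The couplings `Π(μ, ν)`: probability measures on `E × F` with marginals `μ` and `ν`. -/
def couplings (μ : ProbabilityMeasure E) (ν : ProbabilityMeasure F) :
    Set (ProbabilityMeasure (E × F)) :=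
  {π | (π : Measure (E × F)).map Prod.fst = μ ∧ (π : Measure (E × F)).map Prod.snd = ν}

/-- The transport energy `∫ c dπ` of a plan `π`, for a nonnegative cost `c`. -/
def planCost (c : E → F → ℝ≥0) (π : ProbabilityMeasure (E × F)) : ℝ≥0∞ :=
  ∫⁻ z, (c z.1 z.2 : ℝ≥0∞) ∂(π : Measure (E × F))

/-- The optimal couplings `Π*_c(μ, ν)`: the minimisers of `∫ c dπ` over `Π(μ, ν)`. -/
def optimalCouplings (c : E → F → ℝ≥0) (μ : ProbabilityMeasure E) (ν : ProbabilityMeasure F) :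
    Set (ProbabilityMeasure (E × F)) :=
  {π | π ∈ couplings μ ν ∧ IsMinOn (planCost c) (couplings μ ν) π}

end Coupling

section Barycentre

variable {K : ℕ} {X : Type*} {Y : Fin K → Type*}

/-- The total cost `C(x, y₁, …, y_K) = ∑ₖ cₖ(x, yₖ)`. -/
def totalCost (c : ∀ k, X → Y k → ℝ≥0) (x : X) (y : ∀ k, Y k) : ℝ≥0 :=
  ∑ k, c k x (y k)

/-- For all `(y₁, …, y_K)`, the function `x ↦ ∑ₖ cₖ(x, yₖ)` has a unique minimiser. -/
def HasUniqueGroundBarycentres (c : ∀ k, X → Y k → ℝ≥0) : Prop :=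
  ∀ y : ∀ k, Y k, ∃! x : X, IsMinOn (fun x' => totalCost c x' y) Set.univ x

/-- The ground barycentre map `B(y₁, …, y_K) = argmin_x ∑ₖ cₖ(x, yₖ)`. -/
def groundBarycentre (c : ∀ k, X → Y k → ℝ≥0) (hc : HasUniqueGroundBarycentres c)
    (y : ∀ k, Y k) : X :=
  (hc y).choose

variable [MeasurableSpace X] [∀ k, MeasurableSpace (Y k)]

/-- `γ(dx, dy₁, …, dy_K) = μ(dx) π₁ˣ(dy₁) ⋯ π_Kˣ(dy_K)`, where `πₖ(dx, dyₖ) = μ(dx) πₖˣ(dyₖ)` is a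
disintegration of `πₖ` with respect to its first marginal `μ`; here `πₖˣ` is written `κ k x`. -/
def IsCondIndepGluing (μ : ProbabilityMeasure X) (π : ∀ k, ProbabilityMeasure (X × Y k))
    (γ : ProbabilityMeasure (X × (∀ k, Y k))) : Prop :=
  ∃ κ : ∀ k, Kernel X (Y k), (∀ k, IsMarkovKernel (κ k)) ∧
    (∀ k, (π k : Measure (X × Y k)) = (μ : Measure X) ⊗ₘ κ k) ∧
    ∀ S : Set (X × (∀ k, Y k)), MeasurableSet S →
      (γ : Measure (X × (∀ k, Y k))) S
        = ∫⁻ x, Measure.pi (fun k => κ k x) (Prod.mk x ⁻¹' S) ∂(μ : Measure X)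

/-- `Γ_⊗(μ)`: the multi-couplings with optimal bi-marginals `γ_{0,k} ∈ Π*_{cₖ}(μ, νₖ)` that are the
conditionally independent gluing of these bi-marginals. -/
def gammaTensor (c : ∀ k, X → Y k → ℝ≥0) (ν : ∀ k, ProbabilityMeasure (Y k))
    (μ : ProbabilityMeasure X) : Set (ProbabilityMeasure (X × (∀ k, Y k))) :=
  {γ | ∃ π : ∀ k, ProbabilityMeasure (X × Y k),
    (∀ k, π k ∈ optimalCouplings (c k) μ (ν k)) ∧
    (∀ k, (γ : Measure (X × (∀ k, Y k))).map (fun z => (z.1, z.2 k)) = π k) ∧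
    IsCondIndepGluing μ π γ}

/-- `G_⊗(μ) = B # Γ_⊗(μ)`: the laws of `B(Y₁, …, Y_K)` for `(X, Y₁, …, Y_K) ∼ γ ∈ Γ_⊗(μ)`. -/
def GTensor (c : ∀ k, X → Y k → ℝ≥0) (hc : HasUniqueGroundBarycentres c)
    (ν : ∀ k, ProbabilityMeasure (Y k)) (μ : ProbabilityMeasure X) :
    Set (ProbabilityMeasure X) :=
  {ρ | ∃ γ ∈ gammaTensor c ν μ,
    (ρ : Measure X)
      = ((γ : Measure (X × (∀ k, Y k))).map Prod.snd).map (groundBarycentre c hc)}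

end Barycentre

end OTBary

end

/-! Write C for the total cost and V(t) for the sum over k of the optimal costs from μ_t to ν_k.
Replacing x by B(y) lowers C, and the law of (B(y), y_k) under γ_t couples μ_{t+1} with ν_k, so
V(t+1) ≤ ∫ C(B(y), y) dγ_t ≤ ∫ C dγ_t = V(t). Hence V decreases to a limit. If γ_t tends along the
subsequence to some γ' in Γ_⊗(μ), both inequalities become equalities: ∫ C dγ' = ∫ C(B(y), y) dγ'.
Uniqueness of the minimiser gives x = B(y) γ'-almost surely, so the first marginal μ of γ' is B#γ',
an element of G_⊗(μ).

The delicate point is `exists_gammaTensor_limit`: conditional independence is not closed under weak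
limits in general. Finite support rescues it. All μ_t with t ≥ 1 live on one finite set, so γ_t is a
finite sum of slices p(x) δ_x ⊗ (product law). Masses and factors converge separately along an
ultrafilter, and products of converging laws converge. Optimality passes to the limit by
`mem_optimalCouplings_of_tendsto`. -/

namespace OTBary

/-! ### Measures over a finite base, slice by slice. -/

section Slices

variable {E F : Type*} [MeasurableSpace E] [MeasurableSpace F]

/-- The measure `∑ₓ p(x) δₓ`. -/
noncomputable def discreteMeasure (s : Finset E) (p : E → ℝ≥0∞) : Measure E :=
  ∑ x ∈ s, p x • Measure.dirac x

/-- A measure carried by a finite set is the corresponding combination of Dirac masses. -/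
theorem eq_discreteMeasure [MeasurableSingletonClass E] (μ : Measure E) (s : Finset E)
    (h : μ (s : Set E)ᶜ = 0) : μ = discreteMeasure s fun x => μ {x} := by
  classical
  have hs : ∀ t : Finset E, μ.restrict t = discreteMeasure t fun x => μ {x} := by
    intro t
    induction t using Finset.induction_on with
    | empty => simp [discreteMeasure]
    | insert a t ha ih =>
      rw [Finset.coe_insert, Set.insert_eq,
        Measure.restrict_union (by simpa using ha) t.measurableSet, Measure.restrict_singleton, ih,
        discreteMeasure, discreteMeasure, Finset.sum_insert ha]
  rw [← hs s, Measure.restrict_eq_self_of_ae_mem (ae_iff.2 h)]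

/-- The measure `∑ₓ p(x) δₓ ⊗ Pₓ`. -/
noncomputable def slicedMeasure (s : Finset E) (p : E → ℝ≥0∞) (P : E → ProbabilityMeasure F) :
    Measure (E × F) :=
  ∑ x ∈ s, p x • (P x : Measure F).map (Prod.mk x)

theorem lintegral_discreteMeasure [MeasurableSingletonClass E] (s : Finset E) (p : E → ℝ≥0∞)
    (f : E → ℝ≥0∞) : ∫⁻ x, f x ∂(discreteMeasure s p) = ∑ x ∈ s, p x * f x := by
  simp [discreteMeasure, lintegral_smul_measure]

theorem lintegral_slicedMeasure (s : Finset E) (p : E → ℝ≥0∞) (P : E → ProbabilityMeasure F)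
    {f : E × F → ℝ≥0∞} (hf : Measurable f) :
    ∫⁻ z, f z ∂(slicedMeasure s p P) = ∑ x ∈ s, p x * ∫⁻ y, f (x, y) ∂(P x : Measure F) := by
  simp only [slicedMeasure, lintegral_finsetSum_measure, lintegral_smul_measure, smul_eq_mul]
  refine Finset.sum_congr rfl fun x _ => ?_
  rw [lintegral_map hf measurable_prodMk_left]

theorem slicedMeasure_apply (s : Finset E) (p : E → ℝ≥0∞) (P : E → ProbabilityMeasure F)
    {A : Set (E × F)} (hA : MeasurableSet A) :
    slicedMeasure s p P A = ∑ x ∈ s, p x * (P x : Measure F) (Prod.mk x ⁻¹' A) := by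
  simp only [slicedMeasure, Measure.coe_finsetSum, Finset.sum_apply, Measure.smul_apply,
    smul_eq_mul]
  refine Finset.sum_congr rfl fun x _ => ?_
  rw [Measure.map_apply measurable_prodMk_left hA]

theorem slicedMeasure_map_fst (s : Finset E) (p : E → ℝ≥0∞) (P : E → ProbabilityMeasure F) :
    (slicedMeasure s p P).map Prod.fst = discreteMeasure s p := by
  ext A hA
  rw [Measure.map_apply measurable_fst hA, slicedMeasure_apply s p P (measurable_fst hA)]
  simp only [discreteMeasure, Measure.coe_finsetSum, Finset.sum_apply, Measure.smul_apply,
    smul_eq_mul]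
  refine Finset.sum_congr rfl fun x _ => ?_
  rw [Measure.dirac_apply' _ hA]
  by_cases hx : x ∈ A <;> simp [Set.preimage, hx]

theorem compProd_discreteMeasure [MeasurableSingletonClass E] (s : Finset E) (p : E → ℝ≥0∞)
    [SFinite (discreteMeasure s p)] (κ : Kernel E F) [IsMarkovKernel κ]
    (P : E → ProbabilityMeasure F) (h : ∀ x ∈ s, (P x : Measure F) = κ x) :
    discreteMeasure s p ⊗ₘ κ = slicedMeasure s p P := by
  ext A hA
  rw [Measure.compProd_apply hA, lintegral_discreteMeasure, slicedMeasure_apply s p P hA]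
  exact Finset.sum_congr rfl fun x hx => by rw [h x hx]

/-- The base points stay fixed, so weak convergence reduces to convergence of finitely many masses
and fibre laws. -/
theorem tendsto_lintegral_slicedMeasure [TopologicalSpace E] [TopologicalSpace F]
    [CompactSpace F] [OpensMeasurableSpace F] [OpensMeasurableSpace (E × F)]
    {ι : Type*} {l : Filter ι} (s : Finset E) {p : ι → E → ℝ≥0∞} {p' : E → ℝ≥0∞}
    {P : ι → E → ProbabilityMeasure F} {P' : E → ProbabilityMeasure F}
    (hp : ∀ x ∈ s, Tendsto (fun i => p i x) l (𝓝 (p' x))) (hp' : ∀ x ∈ s, p' x ≠ ∞)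
    (hP : ∀ x ∈ s, Tendsto (fun i => P i x) l (𝓝 (P' x)))
    {f : E × F → ℝ≥0} (hf : Continuous f) :
    Tendsto (fun i => ∫⁻ z, f z ∂(slicedMeasure s (p i) (P i))) l
      (𝓝 (∫⁻ z, f z ∂(slicedMeasure s p' P'))) := by
  have hm : Measurable fun z => (f z : ℝ≥0∞) := hf.measurable.coe_nnreal_ennreal
  simp only [lintegral_slicedMeasure _ _ _ hm]
  refine tendsto_finsetSum _ fun x hx => ?_
  let g : BoundedContinuousFunction F ℝ≥0 :=
    BoundedContinuousFunction.mkOfCompact ⟨fun y => f (x, y), by fun_prop⟩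
  have hlim := ProbabilityMeasure.tendsto_iff_forall_lintegral_tendsto.1 (hP x hx) g
  have hfin : ∫⁻ y, (g y : ℝ≥0∞) ∂(P' x : Measure F) ≠ ∞ :=
    (BoundedContinuousFunction.lintegral_lt_top_of_nnreal _ g).ne
  exact ENNReal.Tendsto.mul (hp x hx) (Or.inr hfin) hlim (Or.inr (hp' x hx))

theorem slicedMeasure_pi_map {K : ℕ} {Y : Fin K → Type*} [∀ k, MeasurableSpace (Y k)]
    (s : Finset E) (p : E → ℝ≥0∞) (P : ∀ k, E → ProbabilityMeasure (Y k)) (k : Fin K) :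
    (slicedMeasure s p fun x => ProbabilityMeasure.pi fun k => P k x).map
      (fun z => (z.1, z.2 k)) = slicedMeasure s p (P k) := by
  have hm : Measurable fun z : E × (∀ k, Y k) => (z.1, z.2 k) := by fun_prop
  ext A hA
  rw [Measure.map_apply hm hA, slicedMeasure_apply _ _ _ (hm hA), slicedMeasure_apply _ _ _ hA]
  refine Finset.sum_congr rfl fun x _ => ?_
  have h := (measurePreserving_eval (fun k => (P k x : Measure (Y k))) k).measure_preimage
    (measurable_prodMk_left (x := x) hA).nullMeasurableSet
  rw [← h]
  rfl

end Slices

/-! ### Stability of optimal transport plans. -/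

section Stability

variable {E F : Type*} [MeasurableSpace E] [MeasurableSpace F]

/-- If `λ μ ≤ μ'` then the optimal cost for `μ'` exceeds that of `μ` by at most `M (1 - λ)`. -/
theorem planCost_le_of_smul_le {c : E → F → ℝ≥0} {M : ℝ≥0}
    (hM : ∀ x y, c x y ≤ M) {μ μ' : ProbabilityMeasure E} {ν : ProbabilityMeasure F} {r : ℝ≥0}
    (hle : r • (μ : Measure E) ≤ μ') {π' σ : ProbabilityMeasure (E × F)}
    (hπ' : π' ∈ optimalCouplings c μ' ν) (hσ : σ ∈ couplings μ ν) :
    planCost c π' ≤ planCost c σ + M * (1 - r) := by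
  set d : Measure E := μ' - r • (μ : Measure E) with hd
  have hadd : d + r • (μ : Measure E) = μ' := Measure.sub_add_cancel_of_le hle
  have huniv : d Set.univ + r = 1 := by
    have := congrArg (fun m : Measure E => m Set.univ) hadd
    simpa [Measure.add_apply] using this
  have hd1 : d Set.univ = 1 - r := ENNReal.eq_sub_of_add_eq ENNReal.coe_ne_top huniv
  have hr1 : (r : ℝ≥0∞) ≤ 1 := huniv ▸ le_add_self
  have : IsFiniteMeasure d := ⟨by rw [hd1]; exact tsub_le_self.trans_lt ENNReal.one_lt_top⟩
  -- Competitor for `π'`: keep the fraction `r` of `σ` and send the remaining mass `d`, of total `1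
  -- - r`, independently to `ν`.
  let τ : Measure (E × F) := r • (σ : Measure (E × F)) + d.prod (ν : Measure F)
  have hτ1 : τ.map Prod.fst = μ' := by
    simp only [τ, Measure.map_add _ _ measurable_fst, Measure.map_smul, hσ.1,
      Measure.map_fst_prod, measure_univ, one_smul]
    rw [add_comm, hadd]
  have hτ2 : τ.map Prod.snd = ν := by
    simp only [τ, Measure.map_add _ _ measurable_snd, Measure.map_smul, hσ.2,
      Measure.map_snd_prod, hd1]
    change (r : ℝ≥0∞) • (ν : Measure F) + _ = _
    rw [← add_smul, add_tsub_cancel_of_le hr1, one_smul]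
  have hτp : IsProbabilityMeasure τ := by
    refine ⟨?_⟩
    have := congrArg (fun m : Measure F => m Set.univ) hτ2
    simpa [Measure.map_apply measurable_snd] using this
  have hopt : planCost c π' ≤ planCost c ⟨τ, hτp⟩ := hπ'.2 ⟨hτ1, hτ2⟩
  refine hopt.trans ?_
  simp only [planCost, ProbabilityMeasure.coe_mk, τ, lintegral_add_measure]
  refine add_le_add ?_ ?_
  · rw [ENNReal.smul_def, lintegral_smul_measure, smul_eq_mul]
    exact mul_le_of_le_one_left' hr1
  · calc ∫⁻ z, (c z.1 z.2 : ℝ≥0∞) ∂(d.prod (ν : Measure F))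
        ≤ ∫⁻ _, (M : ℝ≥0∞) ∂(d.prod (ν : Measure F)) :=
          lintegral_mono fun z => ENNReal.coe_le_coe.2 (hM _ _)
      _ = M * (1 - r) := by
          rw [lintegral_const, ← Set.univ_prod_univ, Measure.prod_prod, hd1, measure_univ, mul_one]

/-- Stability of optimal couplings when the first marginals are carried by a common finite set. -/
theorem mem_optimalCouplings_of_tendsto {ι : Type*} {l : Filter ι} [l.NeBot]
    {c : E → F → ℝ≥0} {M : ℝ≥0} (hM : ∀ x y, c x y ≤ M) (s : Finset E)
    {μ : ι → ProbabilityMeasure E} {μ' : ProbabilityMeasure E} {ν : ProbabilityMeasure F}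
    {p : ι → E → ℝ≥0∞} {p' : E → ℝ≥0∞}
    (hμ : ∀ i, (μ i : Measure E) = discreteMeasure s (p i))
    (hμ' : (μ' : Measure E) = discreteMeasure s p')
    (hp : ∀ x ∈ s, Tendsto (fun i => p i x) l (𝓝 (p' x))) (hp' : ∀ x ∈ s, p' x ≠ ∞)
    {π : ι → ProbabilityMeasure (E × F)} {π' : ProbabilityMeasure (E × F)}
    (hπ : ∀ i, π i ∈ optimalCouplings c (μ i) ν) (hπ' : π' ∈ couplings μ' ν)
    (hlim : Tendsto (fun i => planCost c (π i)) l (𝓝 (planCost c π'))) :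
    π' ∈ optimalCouplings c μ' ν := by
  refine ⟨hπ', fun σ hσ => ?_⟩
  -- Taking `r < 1` makes `r * p' x < p' x` strict at each atom, so `r • μ' ≤ μ i` eventually; `r`
  -- tends to 1 afterwards.
  have key : ∀ r : ℝ≥0, r < 1 → planCost c π' ≤ planCost c σ + M * (1 - r) := by
    intro r hr
    have hev : ∀ᶠ i in l, ∀ x ∈ s, r * p' x ≤ p i x := by
      rw [Finset.eventually_all]
      intro x hx
      rcases eq_or_ne (p' x) 0 with h0 | h0
      · simp [h0]
      · have hlt : r * p' x < p' x := by
          simpa using ENNReal.mul_lt_mul_left h0 (hp' x hx) (ENNReal.coe_lt_one_iff.2 hr)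
        filter_upwards [(hp x hx).eventually_const_lt hlt] with i hi using hi.le
    refine le_of_tendsto hlim (hev.mono fun i hi => ?_)
    refine planCost_le_of_smul_le hM ?_ (hπ i) hσ
    rw [hμ, hμ', discreteMeasure, discreteMeasure, Finset.smul_sum]
    refine Finset.sum_le_sum fun x hx => ?_
    rw [ENNReal.smul_def, smul_smul]
    intro A
    simpa using mul_le_mul_left (hi x hx) (Measure.dirac x A)
  have htend : Tendsto (fun r : ℝ≥0 => planCost c σ + M * (1 - (r : ℝ≥0∞))) (𝓝[<] 1)
      (𝓝 (planCost c σ + M * (1 - 1))) := by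
    refine tendsto_const_nhds.add (ENNReal.Tendsto.const_mul ?_ (Or.inr ENNReal.coe_ne_top))
    refine ENNReal.Tendsto.sub tendsto_const_nhds ?_ (Or.inl ENNReal.one_ne_top)
    exact ENNReal.tendsto_coe.2 (tendsto_id.mono_left nhdsWithin_le_nhds)
  simp only [tsub_self, mul_zero, add_zero] at htend
  have : (𝓝[<] (1 : ℝ≥0)).NeBot := nhdsLT_neBot_of_exists_lt ⟨0, one_pos⟩
  exact ge_of_tendsto htend (eventually_nhdsWithin_of_forall fun r hr => key r hr)

end Stability

/-! ### Conditionally independent gluings over a finite base. -/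

section Gluing

variable {K : ℕ} {X : Type*} [MeasurableSpace X] [MeasurableSingletonClass X]
  {Y : Fin K → Type*} [∀ k, MeasurableSpace (Y k)]

/-- A gluing whose first marginal is carried by a finite set is a finite sum of slices. -/
theorem IsCondIndepGluing.eq_slicedMeasure {μ : ProbabilityMeasure X}
    {π : ∀ k, ProbabilityMeasure (X × Y k)} {γ : ProbabilityMeasure (X × (∀ k, Y k))}
    (h : IsCondIndepGluing μ π γ) (s : Finset X) (p : X → ℝ≥0∞)
    (hμ : (μ : Measure X) = discreteMeasure s p) :
    ∃ P : ∀ k, X → ProbabilityMeasure (Y k),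
      (∀ k, (π k : Measure (X × Y k)) = slicedMeasure s p (P k)) ∧
      (γ : Measure (X × (∀ k, Y k)))
        = slicedMeasure s p fun x => ProbabilityMeasure.pi fun k => P k x := by
  obtain ⟨κ, hκ, hπ, hγ⟩ := h
  refine ⟨fun k x => ⟨κ k x, inferInstance⟩, fun k => ?_, ?_⟩
  · have : SFinite (discreteMeasure s p) := hμ ▸ inferInstance
    rw [hπ k, hμ]
    exact compProd_discreteMeasure s p (κ k) _ fun x _ => rfl
  · ext A hA
    rw [hγ A hA, hμ, lintegral_discreteMeasure, slicedMeasure_apply s p _ hA]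
    rfl

theorem isCondIndepGluing_slicedMeasure {μ : ProbabilityMeasure X}
    {π : ∀ k, ProbabilityMeasure (X × Y k)} {γ : ProbabilityMeasure (X × (∀ k, Y k))}
    (s : Finset X) (p : X → ℝ≥0∞) (hμ : (μ : Measure X) = discreteMeasure s p)
    (P : ∀ k, X → ProbabilityMeasure (Y k))
    (hπ : ∀ k, (π k : Measure (X × Y k)) = slicedMeasure s p (P k))
    (hγ : (γ : Measure (X × (∀ k, Y k)))
      = slicedMeasure s p fun x => ProbabilityMeasure.pi fun k => P k x) :
    IsCondIndepGluing μ π γ := by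
  classical
  have hY : ∀ k, Nonempty (Y k) := fun k => by
    obtain ⟨x⟩ : Nonempty X := μ.nonempty
    exact (P k x).nonempty
  -- Off `s`, a `μ`-null set, an arbitrary Dirac mass serves. The kernel is then constant outside a
  -- countable set, hence measurable.
  let κ : ∀ k, Kernel X (Y k) := fun k =>
    ⟨fun x => if x ∈ s then (P k x : Measure (Y k)) else Measure.dirac (Classical.arbitrary _),
      (measurable_const (a := Measure.dirac (Classical.arbitrary (Y k)))).measurable_of_countable_ne
        (s.countable_toSet.mono fun x hx => by
          by_contra hxs
          exact hx (if_neg hxs).symm)⟩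
  have hκs : ∀ k, ∀ x ∈ s, κ k x = P k x := fun k x hx => if_pos hx
  have hκ : ∀ k, IsMarkovKernel (κ k) := fun k => ⟨fun x => by
    by_cases hx : x ∈ s
    · rw [hκs k x hx]
      infer_instance
    · have : κ k x = Measure.dirac (Classical.arbitrary _) := if_neg hx
      rw [this]
      infer_instance⟩
  refine ⟨κ, hκ, fun k => ?_, fun A hA => ?_⟩
  · have : SFinite (discreteMeasure s p) := hμ ▸ inferInstance
    rw [hπ k, hμ]
    exact (compProd_discreteMeasure s p (κ k) _ fun x hx => (hκs k x hx).symm).symm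
  · rw [hγ, hμ, lintegral_discreteMeasure, slicedMeasure_apply s p _ hA]
    refine Finset.sum_congr rfl fun x hx => ?_
    simp only [hκs _ x hx]
    rfl

omit [MeasurableSingletonClass X] in
theorem IsCondIndepGluing.map_fst {μ : ProbabilityMeasure X}
    {π : ∀ k, ProbabilityMeasure (X × Y k)} {γ : ProbabilityMeasure (X × (∀ k, Y k))}
    (h : IsCondIndepGluing μ π γ) : (γ : Measure (X × (∀ k, Y k))).map Prod.fst = μ := by
  classical
  obtain ⟨κ, hκ, -, hγ⟩ := h
  ext A hA
  rw [Measure.map_apply measurable_fst hA, hγ _ (measurable_fst hA), ← lintegral_indicator_one hA]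
  refine lintegral_congr fun x => ?_
  by_cases hx : x ∈ A <;> simp [Set.preimage, hx]

end Gluing

/-! ### Continuity of the ground barycentre map. -/

section GroundBarycentre

variable {K : ℕ} {X : Type*} {Y : Fin K → Type*}

theorem totalCost_groundBarycentre_le (c : ∀ k, X → Y k → ℝ≥0)
    (hc : HasUniqueGroundBarycentres c) (x : X) (y : ∀ k, Y k) :
    totalCost c (groundBarycentre c hc y) y ≤ totalCost c x y :=
  (hc y).choose_spec.1 (Set.mem_univ x)

theorem eq_groundBarycentre (c : ∀ k, X → Y k → ℝ≥0) (hc : HasUniqueGroundBarycentres c)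
    {x : X} {y : ∀ k, Y k}
    (h : totalCost c x y ≤ totalCost c (groundBarycentre c hc y) y) :
    x = groundBarycentre c hc y :=
  (hc y).choose_spec.2 x fun x' _ => h.trans (totalCost_groundBarycentre_le c hc x' y)

variable [TopologicalSpace X] [∀ k, TopologicalSpace (Y k)]

theorem continuous_totalCost {c : ∀ k, X → Y k → ℝ≥0}
    (hcont : ∀ k, Continuous fun z : X × Y k => c k z.1 z.2) :
    Continuous fun z : X × (∀ k, Y k) => totalCost c z.1 z.2 := by
  unfold totalCost
  refine continuous_finsetSum _ fun k _ => ?_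
  exact (hcont k).comp (f := fun z : X × (∀ k, Y k) => (z.1, z.2 k)) (by fun_prop)

/-- The minimal value is an infimum of a jointly continuous function over a compact space. -/
theorem continuous_totalCost_groundBarycentre [CompactSpace X] {c : ∀ k, X → Y k → ℝ≥0}
    (hcont : ∀ k, Continuous fun z : X × Y k => c k z.1 z.2)
    (hc : HasUniqueGroundBarycentres c) :
    Continuous fun y : ∀ k, Y k => totalCost c (groundBarycentre c hc y) y := by
  have h := isCompact_univ.continuous_sInf (f := fun (y : ∀ k, Y k) (x : X) => totalCost c x y)
    (K := Set.univ) ((continuous_totalCost hcont).comp continuous_swap)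
  convert h using 2 with y
  have hleast : IsLeast ((fun x => totalCost c x y) '' Set.univ)
      (totalCost c (groundBarycentre c hc y) y) := by
    refine ⟨⟨_, Set.mem_univ _, rfl⟩, ?_⟩
    rintro _ ⟨x, -, rfl⟩
    exact totalCost_groundBarycentre_le c hc x y
  exact hleast.csInf_eq.symm

/-- By uniqueness, the preimage of a closed `A` is the projection along the compact `X` of the
closed set of minimising pairs with `x ∈ A`. -/
theorem continuous_groundBarycentre [CompactSpace X] {c : ∀ k, X → Y k → ℝ≥0}
    (hcont : ∀ k, Continuous fun z : X × Y k => c k z.1 z.2)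
    (hc : HasUniqueGroundBarycentres c) : Continuous (groundBarycentre c hc) := by
  refine continuous_iff_isClosed.2 fun A hA => ?_
  have hcl := isClosed_le (continuous_totalCost hcont)
    ((continuous_totalCost_groundBarycentre hcont hc).comp (continuous_snd (X := X)))
  have hG : IsClosed {z : X × (∀ k, Y k) | z.1 ∈ A ∧
      totalCost c z.1 z.2 ≤ totalCost c (groundBarycentre c hc z.2) z.2} :=
    (hA.preimage continuous_fst).inter hcl
  convert isClosedMap_snd_of_compactSpace _ hG using 1
  ext y
  constructor
  · intro hy
    exact ⟨(groundBarycentre c hc y, y), ⟨hy, le_rfl⟩, rfl⟩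
  · rintro ⟨⟨x, y⟩, ⟨hx, hxy⟩, rfl⟩
    have h : x = groundBarycentre c hc y := eq_groundBarycentre c hc hxy
    exact h ▸ hx

end GroundBarycentre

/-! ### Support and energy along one step of the iteration. -/

section Iteration

variable {K : ℕ} {X : Type*} [MetricSpace X] [CompactSpace X] [MeasurableSpace X] [BorelSpace X]
  {Y : Fin K → Type*} [∀ k, MetricSpace (Y k)] [∀ k, CompactSpace (Y k)]
  [∀ k, MeasurableSpace (Y k)] [∀ k, BorelSpace (Y k)]
  {c : ∀ k, X → Y k → ℝ≥0} {hc : HasUniqueGroundBarycentres c}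
  {ν : ∀ k, ProbabilityMeasure (Y k)}

omit [CompactSpace X] in
theorem lintegral_totalCost
    (hcont : ∀ k, Continuous fun z : X × Y k => c k z.1 z.2)
    {γ : ProbabilityMeasure (X × (∀ k, Y k))} {π : ∀ k, ProbabilityMeasure (X × Y k)}
    (hγ : ∀ k, (γ : Measure (X × (∀ k, Y k))).map (fun z => (z.1, z.2 k)) = π k) :
    ∫⁻ z, (totalCost c z.1 z.2 : ℝ≥0∞) ∂(γ : Measure (X × (∀ k, Y k)))
      = ∑ k, planCost (c k) (π k) := by
  have hm : ∀ k, Measurable fun z : X × (∀ k, Y k) => (z.1, z.2 k) := fun k => by fun_prop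
  have hck : ∀ k, Measurable fun z : X × Y k => (c k z.1 z.2 : ℝ≥0∞) :=
    fun k => (hcont k).measurable.coe_nnreal_ennreal
  simp only [totalCost, ENNReal.ofNNReal_finsetSum, planCost]
  rw [lintegral_finsetSum _ fun k _ => by exact (hck k).comp (hm k)]
  refine Finset.sum_congr rfl fun k _ => ?_
  rw [← hγ k, lintegral_map (hck k) (hm k)]

/-- The images under `G_⊗` are all carried by the finite set `B(supp ν₁ × ⋯ × supp ν_K)`. -/
theorem exists_finset_compl_null_of_mem_GTensor
    (hcont : ∀ k, Continuous fun z : X × Y k => c k z.1 z.2)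
    (hν : ∀ k, FinitelySupported (ν k : Measure (Y k))) :
    ∃ s : Finset X, ∀ μ ρ : ProbabilityMeasure X, ρ ∈ GTensor c hc ν μ →
      (ρ : Measure X) (s : Set X)ᶜ = 0 := by
  choose F hF hF0 using hν
  have hfin := (Set.Finite.pi' hF).image (groundBarycentre c hc)
  refine ⟨hfin.toFinset, ?_⟩
  rintro μ ρ ⟨γ, ⟨π, hπ, hγπ, -⟩, hρ⟩
  have hB := (continuous_groundBarycentre hcont hc).measurable
  have hms : MeasurableSet ((hfin.toFinset : Set X)ᶜ) := hfin.toFinset.measurableSet.compl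
  rw [hρ, Measure.map_apply hB hms, Measure.map_apply measurable_snd (hB hms)]
  have hsub : Prod.snd ⁻¹' (groundBarycentre c hc ⁻¹' (hfin.toFinset : Set X)ᶜ) ⊆
      ⋃ k, {z : X × (∀ k, Y k) | z.2 k ∈ (F k)ᶜ} := by
    intro z hz
    by_contra hcon
    simp only [Set.mem_iUnion, Set.mem_ofPred_eq, Set.mem_compl_iff, not_exists, not_not] at hcon
    exact hz (hfin.mem_toFinset.2 ⟨z.2, hcon, rfl⟩)
  refine measure_mono_null hsub (measure_iUnion_null fun k => ?_)
  have h1 : (γ : Measure (X × (∀ k, Y k))).map (fun z => z.2 k) = ν k := by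
    rw [← (hπ k).1.2, ← hγπ k, Measure.map_map measurable_snd (by fun_prop)]
    rfl
  have h2 := hF0 k
  rwa [← h1, Measure.map_apply (by fun_prop) (hF k).measurableSet.compl] at h2

/-- The energy of the optimal plans does not exceed the energy of any multi-coupling. -/
theorem sum_planCost_le_lintegral
    (hcont : ∀ k, Continuous fun z : X × Y k => c k z.1 z.2)
    {γ : ProbabilityMeasure (X × (∀ k, Y k))} {ρ : ProbabilityMeasure X}
    (hγ : ∀ k, (γ : Measure (X × (∀ k, Y k))).map (fun z => z.2 k) = ν k)
    (hρ : (ρ : Measure X)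
      = ((γ : Measure (X × (∀ k, Y k))).map Prod.snd).map (groundBarycentre c hc))
    {π : ∀ k, ProbabilityMeasure (X × Y k)} (hπ : ∀ k, π k ∈ optimalCouplings (c k) ρ (ν k)) :
    ∑ k, planCost (c k) (π k) ≤
      ∫⁻ z, (totalCost c (groundBarycentre c hc z.2) z.2 : ℝ≥0∞)
        ∂(γ : Measure (X × (∀ k, Y k))) := by
  have hB := (continuous_groundBarycentre hcont hc).measurable
  have hm : ∀ k, Measurable fun z : X × (∀ k, Y k) => (groundBarycentre c hc z.2, z.2 k) :=
    fun k => (hB.comp measurable_snd).prodMk (by fun_prop)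
  have hck : ∀ k, Measurable fun z : X × Y k => (c k z.1 z.2 : ℝ≥0∞) :=
    fun k => (hcont k).measurable.coe_nnreal_ennreal
  have hle : ∀ k, planCost (c k) (π k) ≤
      ∫⁻ z, (c k (groundBarycentre c hc z.2) (z.2 k) : ℝ≥0∞)
        ∂(γ : Measure (X × (∀ k, Y k))) := by
    intro k
    -- The law of (B(y), y_k) is an admissible competitor.
    have hmem : γ.map (hm k).aemeasurable ∈ couplings ρ (ν k) := by
      constructor
      · rw [ProbabilityMeasure.toMeasure_map, Measure.map_map measurable_fst (hm k), hρ,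
          Measure.map_map hB measurable_snd]
        rfl
      · rw [ProbabilityMeasure.toMeasure_map, Measure.map_map measurable_snd (hm k), ← hγ k]
        rfl
    refine ((hπ k).2 hmem).trans_eq ?_
    rw [planCost, ProbabilityMeasure.toMeasure_map, lintegral_map (hck k) (hm k)]
  refine (Finset.sum_le_sum fun k _ => hle k).trans_eq ?_
  rw [← lintegral_finsetSum _ fun k _ => by exact (hck k).comp (hm k)]
  simp [totalCost]

end Iteration

/-! ### Limits of multi-couplings and the equality case. -/

section Limit

variable {K : ℕ} {X : Type*} [MetricSpace X] [CompactSpace X] [MeasurableSpace X] [BorelSpace X]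
  {Y : Fin K → Type*} [∀ k, MetricSpace (Y k)] [∀ k, CompactSpace (Y k)]
  [∀ k, MeasurableSpace (Y k)] [∀ k, BorelSpace (Y k)]
  {c : ∀ k, X → Y k → ℝ≥0} {hc : HasUniqueGroundBarycentres c}
  {ν : ∀ k, ProbabilityMeasure (Y k)}

/-- If the total cost of a multi-coupling with first marginal `μ` does not exceed the cost of its
ground barycentres, then its barycentre is `μ`. -/
theorem map_groundBarycentre_eq_of_lintegral_le
    (hcont : ∀ k, Continuous fun z : X × Y k => c k z.1 z.2)
    {γ : ProbabilityMeasure (X × (∀ k, Y k))}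
    (hle : ∫⁻ z, (totalCost c z.1 z.2 : ℝ≥0∞) ∂(γ : Measure (X × (∀ k, Y k))) ≤
      ∫⁻ z, (totalCost c (groundBarycentre c hc z.2) z.2 : ℝ≥0∞)
        ∂(γ : Measure (X × (∀ k, Y k)))) :
    (γ : Measure (X × (∀ k, Y k))).map Prod.fst
      = ((γ : Measure (X × (∀ k, Y k))).map Prod.snd).map (groundBarycentre c hc) := by
  have hB := (continuous_groundBarycentre hcont hc).measurable
  have hC := continuous_totalCost (c := c) hcont
  have hm := (continuous_totalCost_groundBarycentre hcont hc).comp (continuous_snd (X := X))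
  have hfin : ∫⁻ z, (totalCost c (groundBarycentre c hc z.2) z.2 : ℝ≥0∞)
      ∂(γ : Measure (X × (∀ k, Y k))) ≠ ∞ :=
    (BoundedContinuousFunction.lintegral_lt_top_of_nnreal _
      (BoundedContinuousFunction.mkOfCompact ⟨_, hm⟩)).ne
  have hae := ae_eq_of_ae_le_of_lintegral_le (μ := (γ : Measure (X × (∀ k, Y k))))
    (Eventually.of_forall fun z =>
      ENNReal.coe_le_coe.2 (totalCost_groundBarycentre_le c hc z.1 z.2))
    hfin hC.measurable.coe_nnreal_ennreal.aemeasurable hle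
  rw [Measure.map_map hB measurable_snd]
  refine Measure.map_congr (hae.mono fun z hz => ?_)
  exact eq_groundBarycentre c hc (ENNReal.coe_le_coe.1 hz.ge)

/-- If multi-couplings `γ_i ∈ Γ_⊗(μ_i)` are such that the `μ_i` are carried by a common finite set
and converge along an ultrafilter, then the `γ_i` converge to some `γ ∈ Γ_⊗(lim μ_i)`, in the sense
of integrals of continuous functions. -/
theorem exists_gammaTensor_limit
    (hcont : ∀ k, Continuous fun z : X × Y k => c k z.1 z.2)
    {ι : Type*} (U : Ultrafilter ι) (s : Finset X) {μ : ι → ProbabilityMeasure X}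
    (hs : ∀ i, (μ i : Measure X) (s : Set X)ᶜ = 0) {μ' : ProbabilityMeasure X}
    (hlim : Tendsto μ U (𝓝 μ')) {γ : ι → ProbabilityMeasure (X × (∀ k, Y k))}
    (hγ : ∀ i, γ i ∈ gammaTensor c ν (μ i)) :
    ∃ γ' ∈ gammaTensor c ν μ', ∀ f : X × (∀ k, Y k) → ℝ≥0, Continuous f →
      Tendsto (fun i => ∫⁻ z, f z ∂(γ i : Measure (X × (∀ k, Y k)))) U
        (𝓝 (∫⁻ z, f z ∂(γ' : Measure (X × (∀ k, Y k))))) := by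
  have hμ := fun i => eq_discreteMeasure (μ i : Measure X) s (hs i)
  let p : ι → X → ℝ≥0∞ := fun i x => (μ i : Measure X) {x}
  choose π hπ hγπ hglue using hγ
  choose P hπP hγP using fun i => (hglue i).eq_slicedMeasure s (p i) (hμ i)
  -- Compactness supplies a limit over every point; where the limiting mass vanishes, the choice is
  -- immaterial.
  have hlimP : ∀ k x, ∃ Q : ProbabilityMeasure (Y k),
      Tendsto (fun i => P i k x) U (𝓝 Q) := fun k x => by
    obtain ⟨Q, -, hQ⟩ := isCompact_univ.ultrafilter_le_nhds (U.map fun i => P i k x) (by simp)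
    exact ⟨Q, hQ⟩
  choose Q hQ using hlimP
  have hlimp : ∀ x, ∃ q : ℝ≥0∞, Tendsto (fun i => p i x) U (𝓝 q) := fun x => by
    obtain ⟨q, -, hq⟩ := isCompact_univ.ultrafilter_le_nhds (U.map fun i => p i x) (by simp)
    exact ⟨q, hq⟩
  choose q hq using hlimp
  have hq1 : ∀ x, q x ≠ ∞ := fun x => ne_top_of_le_ne_top ENNReal.one_ne_top
    (le_of_tendsto (hq x) (Eventually.of_forall fun i => prob_le_one))
  have hμ' : (μ' : Measure X) = discreteMeasure s q := by
    refine ext_of_forall_lintegral_eq_of_IsFiniteMeasure fun f => ?_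
    have h1 := ProbabilityMeasure.tendsto_iff_forall_lintegral_tendsto.1 hlim f
    refine tendsto_nhds_unique h1 ?_
    have h2 : ∀ i, ∫⁻ x, (f x : ℝ≥0∞) ∂(μ i : Measure X) = ∑ x ∈ s, p i x * f x := fun i =>
      (congrArg (fun m => ∫⁻ x, (f x : ℝ≥0∞) ∂m) (hμ i)).trans (lintegral_discreteMeasure s _ _)
    simp only [h2, lintegral_discreteMeasure]
    exact tendsto_finsetSum _ fun x _ =>
      ENNReal.Tendsto.mul_const (hq x) (Or.inr ENNReal.coe_ne_top)
  have hsum : ∑ x ∈ s, q x = 1 := by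
    have h := lintegral_discreteMeasure s q fun _ => 1
    rw [← hμ'] at h
    simpa using h.symm
  have hprobk : ∀ k, IsProbabilityMeasure (slicedMeasure s q (Q k)) := fun k =>
    ⟨by simp [slicedMeasure_apply, hsum]⟩
  have hprob : IsProbabilityMeasure
      (slicedMeasure s q fun x => ProbabilityMeasure.pi fun k => Q k x) :=
    ⟨by simp [slicedMeasure_apply, -ProbabilityMeasure.toMeasure_pi, hsum]⟩
  let π' : ∀ k, ProbabilityMeasure (X × Y k) := fun k => ⟨_, hprobk k⟩
  let γ' : ProbabilityMeasure (X × (∀ k, Y k)) := ⟨_, hprob⟩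
  have hconvπ : ∀ k (f : X × Y k → ℝ≥0), Continuous f →
      Tendsto (fun i => ∫⁻ z, f z ∂(π i k : Measure (X × Y k))) U
        (𝓝 (∫⁻ z, f z ∂(π' k : Measure (X × Y k)))) := by
    intro k f hf
    simp only [hπP]
    exact tendsto_lintegral_slicedMeasure s (fun x _ => hq x) (fun x _ => hq1 x)
      (fun x _ => hQ k x) hf
  have hconvγ : ∀ f : X × (∀ k, Y k) → ℝ≥0, Continuous f →
      Tendsto (fun i => ∫⁻ z, f z ∂(γ i : Measure (X × (∀ k, Y k)))) U
        (𝓝 (∫⁻ z, f z ∂(γ' : Measure (X × (∀ k, Y k))))) := by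
    intro f hf
    simp only [hγP]
    refine tendsto_lintegral_slicedMeasure s (fun x _ => hq x) (fun x _ => hq1 x)
      (fun x _ => ?_) hf
    exact (ProbabilityMeasure.continuous_pi.tendsto fun k => Q k x).comp
      (tendsto_pi_nhds.2 fun k => hQ k x)
  have hcoup : ∀ k, π' k ∈ couplings μ' (ν k) := by
    intro k
    refine ⟨(slicedMeasure_map_fst s q (Q k)).trans hμ'.symm, ?_⟩
    refine (ext_of_forall_lintegral_eq_of_IsFiniteMeasure fun f => ?_).symm
    have hfm : Measurable fun y => (f y : ℝ≥0∞) := f.continuous.measurable.coe_nnreal_ennreal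
    have h1 := hconvπ k (fun z => f z.2) (by fun_prop)
    rw [lintegral_map hfm measurable_snd]
    refine tendsto_nhds_unique ?_ h1
    have h2 : ∀ i, ∫⁻ z, (f z.2 : ℝ≥0∞) ∂(π i k : Measure (X × Y k))
        = ∫⁻ y, f y ∂(ν k : Measure (Y k)) := fun i => by
      rw [← (hπ i k).1.2, lintegral_map hfm measurable_snd]
    simp only [h2]
    exact tendsto_const_nhds
  refine ⟨γ', ⟨π', fun k => ?_, fun k => slicedMeasure_pi_map s q Q k,
    isCondIndepGluing_slicedMeasure s q hμ' Q (fun _ => rfl) rfl⟩, hconvγ⟩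
  obtain ⟨M, hM⟩ := (isCompact_range (hcont k)).bddAbove
  exact mem_optimalCouplings_of_tendsto (fun x y => hM ⟨(x, y), rfl⟩) s hμ hμ'
    (fun x _ => hq x) (fun x _ => hq1 x) (fun i => hπ i k) (hcoup k) (hconvπ k _ (hcont k))

end Limit

end OTBary

/-! ### Energy descent and the fixed-point property. -/

theorem mainTheorem6 {K : ℕ}
    {X : Type*} [MetricSpace X] [CompactSpace X] [MeasurableSpace X] [BorelSpace X]
    {Y : Fin K → Type*} [∀ k, MetricSpace (Y k)] [∀ k, CompactSpace (Y k)]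
    [∀ k, MeasurableSpace (Y k)] [∀ k, BorelSpace (Y k)]
    (c : ∀ k, X → Y k → ℝ≥0)
    (hcont : ∀ k, Continuous fun z : X × Y k => c k z.1 z.2)
    (hc : OTBary.HasUniqueGroundBarycentres c)
    (ν : ∀ k, ProbabilityMeasure (Y k))
    (hν : ∀ k, OTBary.FinitelySupported (ν k : Measure (Y k)))
    (μ : ℕ → ProbabilityMeasure X)
    (hμ₀ : OTBary.FinitelySupported (μ 0 : Measure X))
    (hμ : ∀ t, μ (t + 1) ∈ OTBary.GTensor c hc ν (μ t))
    (μlim : ProbabilityMeasure X) (α : ℕ → ℕ) (hα : StrictMono α)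
    (hlim : Tendsto (fun t => μ (α t)) atTop (𝓝 μlim)) :
    μlim ∈ OTBary.GTensor c hc ν μlim := by
  obtain ⟨s, hs⟩ := OTBary.exists_finset_compl_null_of_mem_GTensor (hc := hc) hcont hν
  choose γ hγ hρ using hμ
  have hγ' := hγ
  choose π hπ hγπ hglue using hγ'
  let V : ℕ → ℝ≥0∞ := fun t => ∑ k, OTBary.planCost (c k) (π t k)
  have hVC : ∀ t, ∫⁻ z, (OTBary.totalCost c z.1 z.2 : ℝ≥0∞)
      ∂(γ t : Measure (X × (∀ k, Y k))) = V t :=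
    fun t => OTBary.lintegral_totalCost hcont (hγπ t)
  have hVB : ∀ t, V (t + 1) ≤
      ∫⁻ z, (OTBary.totalCost c (OTBary.groundBarycentre c hc z.2) z.2 : ℝ≥0∞)
        ∂(γ t : Measure (X × (∀ k, Y k))) := by
    refine fun t => OTBary.sum_planCost_le_lintegral hcont (fun k => ?_) (hρ t) (hπ (t + 1))
    rw [← (hπ t k).1.2, ← hγπ t k, Measure.map_map measurable_snd (by fun_prop)]
    rfl
  have hanti : Antitone V := antitone_nat_of_succ_le fun t =>
    (hVB t).trans <| (hVC t).symm ▸ lintegral_mono fun z =>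
      ENNReal.coe_le_coe.2 (OTBary.totalCost_groundBarycentre_le c hc z.1 z.2)
  have hV := tendsto_atTop_iInf hanti
  -- The shift ensures `β t ≥ 1`, so that `μ (β t)` is an image under G_⊗ and is carried by `s`.
  let β : ℕ → ℕ := fun t => α (t + 1)
  have hβ : Tendsto β atTop atTop := hα.tendsto_atTop.comp (tendsto_add_atTop_nat 1)
  have hβs : ∀ t, (μ (β t) : Measure X) (s : Set X)ᶜ = 0 := fun t => by
    obtain ⟨n, hn⟩ := Nat.exists_eq_succ_of_ne_zero
      ((Nat.succ_pos t).trans_le (hα.le_apply (x := t + 1))).ne'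
    change (μ (α (t + 1)) : Measure X) (s : Set X)ᶜ = 0
    rw [hn]
    exact hs (μ n) _ ⟨γ n, hγ n, hρ n⟩
  let U : Ultrafilter ℕ := Ultrafilter.of atTop
  have hU : (U : Filter ℕ) ≤ atTop := Ultrafilter.of_le atTop
  have hlimU : Tendsto (fun t => μ (β t)) U (𝓝 μlim) :=
    (hlim.comp (tendsto_add_atTop_nat 1)).mono_left hU
  obtain ⟨γ', hγ', hconv⟩ := OTBary.exists_gammaTensor_limit hcont U s hβs hlimU
    fun t => hγ (β t)
  have hC := hconv _ (OTBary.continuous_totalCost hcont)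
  have hB := hconv _
    ((OTBary.continuous_totalCost_groundBarycentre hcont hc).comp (continuous_snd (X := X)))
  simp only [hVC] at hC
  -- `V (β t)` and `V (β t + 1)` share the limit of `V`: the first is the total cost, the second is
  -- bounded by the barycentre cost.
  have hle := tendsto_nhds_unique hC ((hV.comp hβ).mono_left hU) ▸
    le_of_tendsto_of_tendsto
      ((hV.comp ((tendsto_add_atTop_nat 1).comp hβ)).mono_left hU) hB
      (Eventually.of_forall fun t => hVB (β t))
  refine ⟨γ', hγ', ?_⟩
  obtain ⟨π', -, -, hglue'⟩ := hγ'
  rw [← OTBary.map_groundBarycentre_eq_of_lintegral_le hcont hle, hglue'.map_fst]
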